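/- Let $k$ be a field and let $\mathcal K\colon K_0\to K_1\to\dots\to K_N$ be a finite sequence of continuous maps of topological spaces such that the singular homology $H_q(K_i)=H_q(K_i;k)$ is finite dimensional for all $i$ and $q$. Write $f^{i,j}_p\colon H_p(K_i)\to H_p(K_j)$ for the maps induced by the compositions $K_i\to\dots\to K_j$. Endow each $H_*(K_i)$ with the $A_\infty$-coalgebra structure $\{\Delta_n\colon H_*(K_i)\to H_*(K_i)^{\otimes n}\}_{n\ge 1}$ transferred, by the homotopy transfer theorem, from the differential graded coalgebra of singular chains $C_*(K_i)$ with the Alexander–Whitney diagonal, along any transfer diagram $$\iota\colon (H_*(K_i),0)\to (C_*(K_i),d),\qquad p\colon (C_*(K_i),d)\to (H_*(K_i),0),\qquad \phi\colon C_*(K_i)\to C_{*+1}(K_i),$$ with $\iota$ and $p$ chain maps inducing the identity in homology, $p\iota=\mathrm{id}$, $p\phi=\phi\iota=\phi^2=0$ and $\phi d+d\phi=\iota p-\mathrm{id}$. Fix $n\ge 1$ and $p\ge 0$, write $\Delta_n^i$ for the restriction of $\Delta_n$ to $H_p(K_i)$, and for $0\le i\le j\le N$ let $$(\Delta_n)^{i,j}_p(\mathcal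 K)=f^{i,j}_p\Big(\bigcap_{l=i}^{j}\ker\big(\Delta_n^l\circ f^{i,l}_p\big)\Big)\subseteq H_p(K_j).$$ Let $\mathbf V$ be the zigzag module of kernels $$V_0\leftarrow W_0\to V_1\leftarrow W_1\to\dots\leftarrow W_{N-1}\to V_N,\qquad V_l=\ker\Delta_n^l,\quad W_l=\ker\Delta_n^l\cap\ker\big(\Delta_n^{l+1}\circ f^{l,l+1}_p\big),$$ whose backward maps are the inclusions and whose forward maps are the restrictions of $f^{l,l+1}_p$. Then $\mathbf V$ is isomorphic to a finite direct sum of interval zigzag modules $\bigoplus_m \mathbf I^m$. In any such decomposition each interval $\mathbf I^m$ is born at some $V_{i_m}$; if it dies at $V_{j_m}$ or at $W_{j_m}$, let its bar be $[i_m,j_m]$. The multiset of all these bars (the $\Delta_n$-barcode of $\mathcal K$ in degree $p$) does not depend on the decomposition, and for all $0\le i\le j\le N$, $$\dim (\Delta_n)^{i,j}_p(\mathcal K)=\#\{m : i_m\le i \text{ and } j\le j_m\},$$ the number of bars of the $\Delta_n$-barcode that contain the interval $[i,j]$. -/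

import Mathlib

open CategoryTheory AlgebraicTopology
open scoped TensorProduct DirectSum Simplicial

universe u v w

noncomputable section

/-! ### Singular chains, singular homology and the Alexander–Whitney diagonal -/

section Chains

variable (k : Type u) [Field k]

/-- The singular chain complex `C_*(X)` with coefficients in the field `k`. -/
abbrev singChains (X : TopCat.{u}) : ChainComplex (ModuleCat.{u} k) ℕ :=
  (TopCat.toSSet.obj X).chainComplex (ModuleCat.of k k)

/-- The singular homology `H_q(X)` with coefficients in the field `k`. -/
abbrev singHomology (q : ℕ) (X : TopCat.{u}) : ModuleCat.{u} k :=
  ((singularHomologyFunctor (ModuleCat.{u} k) q).obj (ModuleCat.of k k)).obj X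

/-- The linear map `H_q(X) → H_q(Y)` induced by a continuous map `f : X → Y`. -/
abbrev singHomologyMap (q : ℕ) {X Y : TopCat.{u}} (f : X ⟶ Y) :
    singHomology k q X →ₗ[k] singHomology k q Y :=
  (((singularHomologyFunctor (ModuleCat.{u} k) q).obj (ModuleCat.of k k)).map f).hom

/-- The underlying module of all singular chains, `⨁ q, C_q(X)`. -/
abbrev TotalChains (X : TopCat.{u}) : Type u := ⨁ q : ℕ, (singChains k X).X q

/-- The total singular homology `H_*(X) = ⨁ q, H_q(X)`. -/
abbrev TotalHomology (X : TopCat.{u}) : Type u := ⨁ q : ℕ, singHomology k q X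

/-- A singular simplex, as an element of the total module of singular chains. -/
def simplexChain (X : TopCat.{u}) {q : ℕ} (x : (TopCat.toSSet.obj X) _⦋q⦌) : TotalChains k X :=
  DirectSum.lof k ℕ (fun q => (singChains k X).X q) q
    (((TopCat.toSSet.obj X).ιChainComplex (R := ModuleCat.of k k) x).hom 1)

/-- The front `a`-face of a `q`-simplex, spanned by the vertices `0, …, a`. -/
def frontFace (X : TopCat.{u}) {q : ℕ} (x : (TopCat.toSSet.obj X) _⦋q⦌) (a : ℕ) (ha : a ≤ q) :
    (TopCat.toSSet.obj X) _⦋a⦌ :=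
  (TopCat.toSSet.obj X).map (SimplexCategory.subinterval 0 a (by omega)).op x

/-- The back `(q - a)`-face of a `q`-simplex, spanned by the vertices `a, …, q`. -/
def backFace (X : TopCat.{u}) {q : ℕ} (x : (TopCat.toSSet.obj X) _⦋q⦌) (a : ℕ) (ha : a ≤ q) :
    (TopCat.toSSet.obj X) _⦋q - a⦌ :=
  (TopCat.toSSet.obj X).map (SimplexCategory.subinterval a (q - a) (by omega)).op x

/-- The Alexander–Whitney diagonal of a `q`-simplex:
the sum over `0 ≤ a ≤ q` of `(front a-face) ⊗ (back (q-a)-face)`. -/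
def alexanderWhitneySimplex (X : TopCat.{u}) {q : ℕ} (x : (TopCat.toSSet.obj X) _⦋q⦌) :
    TotalChains k X ⊗[k] TotalChains k X :=
  ∑ a : Fin (q + 1),
    simplexChain k X (frontFace X x a (Nat.lt_succ_iff.mp a.isLt)) ⊗ₜ[k]
      simplexChain k X (backFace X x a (Nat.lt_succ_iff.mp a.isLt))

/-- The Alexander–Whitney diagonal `C_q(X) → C_*(X) ⊗ C_*(X)`. -/
def alexanderWhitneyDegree (X : TopCat.{u}) (q : ℕ) :
    (singChains k X).X q →ₗ[k] TotalChains k X ⊗[k] TotalChains k X :=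
  (((TopCat.toSSet.obj X).isColimitChainComplexXCofan (ModuleCat.of k k) q).desc
    (Limits.Cofan.mk (ModuleCat.of k (TotalChains k X ⊗[k] TotalChains k X)) fun x =>
      ModuleCat.ofHom (LinearMap.toSpanSingleton k _ (alexanderWhitneySimplex k X x)))).hom

/-- The Alexander–Whitney diagonal `Δ : C_*(X) → C_*(X) ⊗ C_*(X)`. -/
def alexanderWhitney (X : TopCat.{u}) :
    TotalChains k X →ₗ[k] TotalChains k X ⊗[k] TotalChains k X :=
  DirectSum.toModule k ℕ _ (alexanderWhitneyDegree k X)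

end Chains

/-! ### The transferred `A_∞`-coalgebra operations on homology -/

/-- A transfer diagram from the singular chains `(C_*(X), d)` to the homology `(H_*(X), 0)`:
chain maps `ι`, `p` and a homotopy `φ` with `p ι = id`, `p φ = φ ι = φ² = 0` and
`φ d + d φ = ι p - id`, where `p` sends every cycle to its homology class (equivalently,
`ι α` is a cycle representing `α`). -/
structure TransferDiagram (k : Type u) [Field k] (X : TopCat.{u}) where
  /-- the inclusion `ι` -/
  incl : ∀ q, singHomology k q X →ₗ[k] (singChains k X).X q
  /-- the projection `p` -/
  proj : ∀ q, (singChains k X).X q →ₗ[k] singHomology k q X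
  /-- the homotopy `φ`, of degree `1` -/
  homotopy : ∀ q, (singChains k X).X q →ₗ[k] (singChains k X).X (q + 1)
  d_incl : ∀ q, ((singChains k X).d (q + 1) q).hom ∘ₗ incl (q + 1) = 0
  proj_d : ∀ q, proj q ∘ₗ ((singChains k X).d (q + 1) q).hom = 0
  proj_cycle : ∀ (q : ℕ) (z : (singChains k X).cycles q),
    proj q (((singChains k X).iCycles q).hom z) = ((singChains k X).homologyπ q).hom z
  proj_incl : ∀ q, proj q ∘ₗ incl q = LinearMap.id
  proj_homotopy : ∀ q, proj (q + 1) ∘ₗ homotopy q = 0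
  homotopy_incl : ∀ q, homotopy q ∘ₗ incl q = 0
  homotopy_homotopy : ∀ q, homotopy (q + 1) ∘ₗ homotopy q = 0
  homotopy_relation_zero :
    ((singChains k X).d 1 0).hom ∘ₗ homotopy 0 = incl 0 ∘ₗ proj 0 - LinearMap.id
  homotopy_relation_succ : ∀ q,
    homotopy q ∘ₗ ((singChains k X).d (q + 1) q).hom +
      ((singChains k X).d (q + 2) (q + 1)).hom ∘ₗ homotopy (q + 1) =
    incl (q + 1) ∘ₗ proj (q + 1) - LinearMap.id

namespace TransferDiagram

/-- Every linear map over a field has a generalized inverse. -/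
theorem exists_genInverse {k : Type u} [Field k] {M : Type v} {M' : Type w}
    [AddCommGroup M] [Module k M] [AddCommGroup M'] [Module k M'] (d : M →ₗ[k] M') :
    ∃ s : M' →ₗ[k] M, ∀ x, d (s (d x)) = d x := by
  obtain ⟨g, hg⟩ := d.rangeRestrict.exists_rightInverse_of_surjective d.range_rangeRestrict
  obtain ⟨r, hr⟩ := (LinearMap.range d).subtype.exists_leftInverse_of_injective
    (LinearMap.range d).ker_subtype
  refine ⟨g ∘ₗ r, fun x => ?_⟩
  have h1 : r (d x) = d.rangeRestrict x := LinearMap.congr_fun hr (d.rangeRestrict x)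
  have h2 := LinearMap.congr_fun hg (d.rangeRestrict x)
  simpa [h1] using congrArg Subtype.val h2

/-- Transfer diagrams exist for every space. -/
theorem nonempty (k : Type u) [Field k] (X : TopCat.{u}) : Nonempty (TransferDiagram k X) := by
  let S := singChains k X
  let d : ∀ q, S.X (q + 1) →ₗ[k] S.X q := fun q => (S.d (q + 1) q).hom
  have dd : ∀ q x, d q (d (q + 1) x) = 0 := fun q x => by
    have := S.d_comp_d (q + 2) (q + 1) q
    exact LinearMap.congr_fun (congrArg ModuleCat.Hom.hom this) x
  choose s hs using fun q => exists_genInverse (d q)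
  let a : ∀ q, S.X q →ₗ[k] S.X q := fun q => match q with
    | 0 => 0
    | q + 1 => s q ∘ₗ d q
  have ad : ∀ q x, a q (d q x) = 0 := fun q x => by
    cases q with
    | zero => rfl
    | succ q => simp [a, dd]
  let Z : ∀ q, ModuleCat k := fun q => S.cycles q
  let i : ∀ q, Z q →ₗ[k] S.X q := fun q => (S.iCycles q).hom
  let π : ∀ q, Z q →ₗ[k] singHomology k q X := fun q => (S.homologyπ q).hom
  have ai : ∀ q z, a q (i q z) = 0 := fun q z => by
    cases q with
    | zero => rfl
    | succ q =>
      have : d q (i (q + 1) z) = 0 :=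
        LinearMap.congr_fun (congrArg ModuleCat.Hom.hom (S.iCycles_d (q + 1) q)) z
      simp [a, this]
  -- cycles
  have da : ∀ q x, d q (x - a (q + 1) x) = 0 := fun q x => by simp [a, hs]
  have hZ0 : ∀ q x, (S.d q ((ComplexShape.down ℕ).next q)).hom (x - a q x) = 0 := by
    intro q x
    cases q with
    | zero =>
      rw [S.shape]
      · rfl
      · simp
    | succ q =>
      have h : (ComplexShape.down ℕ).next (q + 1) = q := by simp
      rw [h]
      exact da q x
  have hlift : ∀ q, ∃ c : S.X q →ₗ[k] Z q, ∀ x, i q (c x) = x - a q x := fun q => by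
    let f : S.X q ⟶ S.X q := ModuleCat.ofHom (LinearMap.id - a q)
    have hf : f ≫ S.d q ((ComplexShape.down ℕ).next q) = 0 := by
      ext x
      exact hZ0 q x
    refine ⟨(S.liftCycles f _ rfl hf).hom, fun x => ?_⟩
    exact LinearMap.congr_fun (congrArg ModuleCat.Hom.hom (S.liftCycles_i f _ rfl hf)) x
  choose c hc using hlift
  have ii : ∀ q, Function.Injective (i q) := fun q =>
    (ModuleCat.mono_iff_injective _).mp (inferInstanceAs (Mono (S.iCycles q)))
  have πs : ∀ q, Function.Surjective (π q) := fun q =>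
    (ModuleCat.epi_iff_surjective _).mp (inferInstanceAs (Epi (S.homologyπ q)))
  choose σ hσ using fun q => (π q).exists_rightInverse_of_surjective
    (LinearMap.range_eq_top.mpr (πs q))
  -- a cycle has class zero if and only if it is a boundary
  have hB : ∀ q z, π q z = 0 ↔ ∃ y, d q y = i q z := fun q z => by
    have h : (ComplexShape.down ℕ).prev q = q + 1 := by simp
    have hex := (ShortComplex.mk (S.toCycles (q + 1) q) (S.homologyπ q)
      (S.toCycles_comp_homologyπ _ _)).exact_of_g_is_cokernel (S.homologyIsCokernel (q + 1) q h)
    have hti : ∀ y, i q ((S.toCycles (q + 1) q).hom y) = d q y := fun y =>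
      LinearMap.congr_fun (congrArg ModuleCat.Hom.hom (S.toCycles_i (q + 1) q)) y
    constructor
    · intro hz
      obtain ⟨y, hy⟩ := (ShortComplex.moduleCat_exact_iff _).mp hex z hz
      have hy' : (S.toCycles (q + 1) q).hom y = z := hy
      exact ⟨y, by rw [← hti, hy']⟩
    · rintro ⟨y, hy⟩
      rw [← hti] at hy
      rw [← ii q hy]
      exact LinearMap.congr_fun
        (congrArg ModuleCat.Hom.hom (S.toCycles_comp_homologyπ (q + 1) q)) y
  have dc : ∀ q x, d q (i (q + 1) x) = 0 := fun q z =>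
    LinearMap.congr_fun (congrArg ModuleCat.Hom.hom (S.iCycles_d (q + 1) q)) z
  have ci : ∀ q z, c q (i q z) = z := fun q z => ii q (by rw [hc, ai, sub_zero])
  have πσ : ∀ q x, π q (σ q x) = x := fun q x => LinearMap.congr_fun (hσ q) x
  have cd : ∀ q y, i q (c q (d q y)) = d q y := fun q y => by rw [hc, ad, sub_zero]
  have πcd : ∀ q y, π q (c q (d q y)) = 0 := fun q y => (hB q _).mpr ⟨y, (cd q y).symm⟩
  have ca : ∀ q x, c q (a q x) = 0 := fun q x => ii q (by
    rw [hc, map_zero]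
    cases q with
    | zero => simp [a]
    | succ q => simp [a, hs])
  -- the projection along the boundaries
  have hb : ∀ q z, i q z - d q (s q (i q z)) =
      i q (σ q (π q z)) - d q (s q (i q (σ q (π q z)))) := fun q z => by
    obtain ⟨y, hy⟩ := (hB q (z - σ q (π q z))).mp (by rw [map_sub, πσ, sub_self])
    have h1 : d q (s q (i q (z - σ q (π q z)))) = i q (z - σ q (π q z)) := by rw [← hy, hs]
    simp only [map_sub] at h1
    rw [sub_eq_sub_iff_sub_eq_sub, h1]
  have hcd0 : ∀ q x, c (q + 1) (s q (d q x)) = 0 := fun q x => ca (q + 1) x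
  have ic : ∀ q x, i q (c q x) = x - a q x := hc
  refine ⟨{
    incl := fun q => (LinearMap.id - d q ∘ₗ s q) ∘ₗ i q ∘ₗ σ q
    proj := fun q => π q ∘ₗ c q
    homotopy := fun q => -(s q ∘ₗ d q ∘ₗ s q ∘ₗ i q ∘ₗ c q)
    d_incl := fun q => ?_
    proj_d := fun q => ?_
    proj_cycle := fun q z => ?_
    proj_incl := fun q => ?_
    proj_homotopy := fun q => ?_
    homotopy_incl := fun q => ?_
    homotopy_homotopy := fun q => ?_
    homotopy_relation_zero := ?_
    homotopy_relation_succ := fun q => ?_ }⟩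
  · refine LinearMap.ext fun x => ?_
    change d q (i (q + 1) (σ (q + 1) x) - d (q + 1) (s (q + 1) (i (q + 1) (σ (q + 1) x)))) = 0
    rw [map_sub, dc, dd, sub_zero]
  · exact LinearMap.ext fun y => πcd q y
  · change π q (c q (i q z)) = π q z
    rw [ci]
  · refine LinearMap.ext fun x => ?_
    change π q (c q (i q (σ q x) - d q (s q (i q (σ q x))))) = x
    rw [map_sub, map_sub, πcd, ci, πσ, sub_zero]
  · refine LinearMap.ext fun x => ?_
    change π (q + 1) (c (q + 1) (-(s q (d q (s q (i q (c q x))))))) = 0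
    rw [map_neg, hcd0, neg_zero, map_zero]
  · refine LinearMap.ext fun x => ?_
    change -(s q (d q (s q (i q (c q (i q (σ q x) - d q (s q (i q (σ q x))))))))) = 0
    rw [map_sub (c q), ci, map_sub (i q), cd, map_sub (s q), map_sub (d q), hs, sub_self,
      map_zero, neg_zero]
  · refine LinearMap.ext fun x => ?_
    change -(s (q + 1) (d (q + 1) (s (q + 1) (i (q + 1)
      (c (q + 1) (-(s q (d q (s q (i q (c q x)))))))))))= 0
    rw [map_neg (c (q + 1)), hcd0, neg_zero, map_zero, map_zero, map_zero, map_zero, neg_zero]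
  · refine LinearMap.ext fun x => ?_
    change d 0 (-(s 0 (d 0 (s 0 (i 0 (c 0 x)))))) =
      i 0 (σ 0 (π 0 (c 0 x))) - d 0 (s 0 (i 0 (σ 0 (π 0 (c 0 x))))) - x
    rw [← hb, map_neg, hs, ic]
    simp [a]
  · refine LinearMap.ext fun x => ?_
    change -(s q (d q (s q (i q (c q (d q x)))))) +
        d (q + 1) (-(s (q + 1) (d (q + 1) (s (q + 1) (i (q + 1) (c (q + 1) x)))))) =
      i (q + 1) (σ (q + 1) (π (q + 1) (c (q + 1) x))) -
        d (q + 1) (s (q + 1) (i (q + 1) (σ (q + 1) (π (q + 1) (c (q + 1) x))))) - x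
    rw [← hb, map_neg, hs, cd, hs, ic]
    simp only [a, LinearMap.comp_apply]
    abel

variable {k : Type u} [Field k] {X : TopCat.{u}} (T : TransferDiagram k X)

/-- `ι : H_*(X) → C_*(X)` -/
def totalIncl : TotalHomology k X →ₗ[k] TotalChains k X := DirectSum.lmap T.incl

/-- `p : C_*(X) → H_*(X)` -/
def totalProj : TotalChains k X →ₗ[k] TotalHomology k X := DirectSum.lmap T.proj

/-- `φ : C_*(X) → C_*(X)` -/
def totalHomotopy : TotalChains k X →ₗ[k] TotalChains k X :=
  DirectSum.toModule k ℕ _ fun q =>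
    DirectSum.lof k ℕ (fun q => (singChains k X).X q) (q + 1) ∘ₗ T.homotopy q

/-!
The operations are transferred in the desuspended form, on `s⁻¹ C_*(X)` and `s⁻¹ H_*(X)`, where all
the structure maps `d_n` of the tensor algebra differentials have degree `-1` and the formula of the
homotopy transfer theorem (a sum over planar binary trees) has no further signs. The module
`s⁻¹ M` is represented by the same underlying module as `M`, an element `x` of `M` standing for
`s⁻¹ x`.
-/

/-- The quadratic part `d₂ = -(s⁻¹ ⊗ s⁻¹) Δ s` of the differential of the tensor algebra on
`s⁻¹ C_*(X)`. As `(s⁻¹ ⊗ s⁻¹)(a ⊗ b) = (-1)^|a| s⁻¹ a ⊗ s⁻¹ b`, it sends `s⁻¹ x` to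
`-∑ (-1)^|x'| s⁻¹ x' ⊗ s⁻¹ x''` if `Δ x = ∑ x' ⊗ x''`. -/
def quadraticPart (k : Type u) [Field k] (X : TopCat.{u}) :
    TotalChains k X →ₗ[k] TotalChains k X ⊗[k] TotalChains k X :=
  -(TensorProduct.map
    (DirectSum.lmap fun q => ((-1 : k) ^ q) • (LinearMap.id : (singChains k X).X q →ₗ[k] _))
    LinearMap.id ∘ₗ alexanderWhitney k X)

/-- Given maps `h_m : C → C^{⊗ m}` for `m < n`, the map
`∑_{a + b = n, a, b ≥ 1} (h_a ⊗ h_b) d₂ : C → C^{⊗ n}`. -/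
def graft (k : Type u) [Field k] (X : TopCat.{u}) (n : ℕ)
    (h : ∀ m < n, TotalChains k X →ₗ[k] (⨂[k]^m) (TotalChains k X)) :
    TotalChains k X →ₗ[k] (⨂[k]^n) (TotalChains k X) :=
  ∑ a : Finset.Ioo 0 n,
    (TensorPower.cast k (TotalChains k X)
        (Nat.add_sub_cancel' (Finset.mem_Ioo.mp a.2).2.le)).toLinearMap ∘ₗ
      TensorPower.mulEquiv.toLinearMap ∘ₗ
      TensorProduct.map (h a.1 (Finset.mem_Ioo.mp a.2).2)
        (h (n - a.1) (by have := Finset.mem_Ioo.mp a.2; omega)) ∘ₗ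
      quadraticPart k X

/-- The maps `h_n : C → C^{⊗ n}` with `h_1 = id` and
`h_n = (∑_{a + b = n} (h_a ⊗ h_b) d₂) φ'` for `n ≥ 2`: the sum over the planar binary trees with
`n` leaves, all of whose edges other than the leaves (the root edge included) carry the desuspended
homotopy `φ' = - s⁻¹ φ s`. -/
def branch (n : ℕ) : TotalChains k X →ₗ[k] (⨂[k]^n) (TotalChains k X) :=
  if hn : n = 1 then
    (TensorPower.cast k (TotalChains k X) hn.symm).toLinearMap ∘ₗ
      (PiTensorProduct.subsingletonEquiv (R := k) (s := fun _ => TotalChains k X)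
        (0 : Fin 1)).symm.toLinearMap
  else
    graft k X n (fun m _ => branch m) ∘ₗ (-T.totalHomotopy)
termination_by n

/-- The component `d_n : s⁻¹ H → (s⁻¹ H)^{⊗ n}` of the transferred differential of the completed
tensor algebra on `s⁻¹ H_*(X)`: the sum over the planar binary trees with `n` leaves whose root is
labelled by `ι`, whose leaves are labelled by `p`, whose internal edges are labelled by `φ'` and
whose vertices are labelled by `d₂`. It vanishes for `n = 1`. -/
def transferredDifferential (n : ℕ) :
    TotalHomology k X →ₗ[k] (⨂[k]^n) (TotalHomology k X) :=
  PiTensorProduct.map (fun _ => T.totalProj) ∘ₗ graft k X n (fun m _ => T.branch m) ∘ₗ T.totalIncl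

/-- The map `s^{⊗ n} : (s⁻¹ H)^{⊗ n} → H^{⊗ n}`, which sends
`s⁻¹ x_1 ⊗ ⋯ ⊗ s⁻¹ x_n` to `(-1)^{∑ (n - i) (|x_i| - 1)} x_1 ⊗ ⋯ ⊗ x_n`. (The index `i : Fin n`
starts at `0`, and `|x_i| + 1` has the parity of `|x_i| - 1`.) -/
def suspensionPower (k : Type u) [Field k] (X : TopCat.{u}) (n : ℕ) :
    (⨂[k]^n) (TotalHomology k X) →ₗ[k] (⨂[k]^n) (TotalHomology k X) :=
  PiTensorProduct.map fun i : Fin n => DirectSum.lmap fun q =>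
    ((-1 : k) ^ ((n - 1 - (i : ℕ)) * (q + 1))) • (LinearMap.id : singHomology k q X →ₗ[k] _)

/-- The operation `Δ_n : H_*(X) → H_*(X)^{⊗ n}` of the `A_∞`-coalgebra structure on `H_*(X)`
transferred from the differential graded coalgebra of singular chains. It is determined by
`d_n = -(s⁻¹)^{⊗ n} Δ_n s`, that is, `Δ_n = -(-1)^{n (n - 1) / 2} s^{⊗ n} d_n s⁻¹`, the convention
for which the `A_∞`-coalgebra relations read
`∑_{i, l} (-1)^{i + l + i l} (1^{⊗ (n - i - l)} ⊗ Δ_i ⊗ 1^{⊗ l}) Δ_{n - i + 1} = 0`. In particular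
`Δ_1 = 0` and `Δ_2 = (p ⊗ p) Δ ι`. -/
def Delta (n : ℕ) : TotalHomology k X →ₗ[k] (⨂[k]^n) (TotalHomology k X) :=
  (-(-1 : k) ^ (n * (n - 1) / 2)) • (suspensionPower k X n ∘ₗ T.transferredDifferential n)

/-- The restriction of `Δ_n` to `H_p(X)`. -/
def DeltaDegree (n p : ℕ) : singHomology k p X →ₗ[k] (⨂[k]^n) (TotalHomology k X) :=
  T.Delta n ∘ₗ DirectSum.lof k ℕ (fun q => singHomology k q X) p

end TransferDiagram

/-! ### Zigzag modules and interval decompositions -/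

/-- A zigzag module of the shape `V_0 ← W_0 → V_1 ← W_1 → ⋯ ← W_{N-1} → V_N`. -/
structure ZigzagModule (k : Type u) [Field k] (N : ℕ) where
  V : Fin (N + 1) → ModuleCat.{v} k
  W : Fin N → ModuleCat.{v} k
  backward : ∀ l : Fin N, W l →ₗ[k] V l.castSucc
  forward : ∀ l : Fin N, W l →ₗ[k] V l.succ

namespace ZigzagModule

variable {k : Type u} [Field k] {N : ℕ}

/-- An isomorphism of zigzag modules: linear isomorphisms commuting with the structure maps. -/
structure Iso (U : ZigzagModule.{u, v} k N) (U' : ZigzagModule.{u, w} k N) where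
  equivV : ∀ l, U.V l ≃ₗ[k] U'.V l
  equivW : ∀ l, U.W l ≃ₗ[k] U'.W l
  comm_backward : ∀ l x, equivV l.castSucc (U.backward l x) = U'.backward l (equivW l x)
  comm_forward : ∀ l x, equivV l.succ (U.forward l x) = U'.forward l (equivW l x)

/-- The direct sum of a family of zigzag modules. -/
def directSum {ι : Type} (U : ι → ZigzagModule.{u, v} k N) : ZigzagModule.{u, v} k N where
  V l := ModuleCat.of k (⨁ m, (U m).V l)
  W l := ModuleCat.of k (⨁ m, (U m).W l)
  backward l := DirectSum.lmap fun m => (U m).backward l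
  forward l := DirectSum.lmap fun m => (U m).forward l

/-- The space of an interval module at the position `t`: it is `k` if `b ≤ t ≤ d`, and `0`
otherwise. -/
def intervalSpace (k : Type u) [Field k] (b d t : ℕ) : Submodule k k :=
  if b ≤ t ∧ t ≤ d then ⊤ else ⊥

/-- A structure map of an interval module from the position `t` to the position `t'`: it is the
identity of `k` if both spaces are `k`, and `0` otherwise. -/
def intervalMap (k : Type u) [Field k] (b d t t' : ℕ) :
    intervalSpace k b d t →ₗ[k] intervalSpace k b d t' :=
  if h : b ≤ t' ∧ t' ≤ d then
    LinearMap.codRestrict _ (Submodule.subtype _) fun _ => by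
      rw [intervalSpace, if_pos h]; exact Submodule.mem_top
  else 0

/-- The interval module with birth time `b` and death time `d`. The spaces of a zigzag module are
numbered from left to right: `V_l` is at the position `2 l` and `W_l` is at the position
`2 l + 1`. -/
def interval (k : Type u) [Field k] (N b d : ℕ) : ZigzagModule.{u, u} k N where
  V l := ModuleCat.of k (intervalSpace k b d (2 * (l : ℕ)))
  W l := ModuleCat.of k (intervalSpace k b d (2 * (l : ℕ) + 1))
  backward l := intervalMap k b d (2 * (l : ℕ) + 1) (2 * (l : ℕ))
  forward l := intervalMap k b d (2 * (l : ℕ) + 1) (2 * ((l.succ : Fin (N + 1)) : ℕ))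

/-- A decomposition of a zigzag module as a finite direct sum of intervals. -/
structure IntervalDecomposition (U : ZigzagModule.{u, v} k N) where
  /-- the number of intervals -/
  size : ℕ
  birth : Fin size → ℕ
  death : Fin size → ℕ
  birth_le_death : ∀ m, birth m ≤ death m
  death_le : ∀ m, death m ≤ 2 * N
  iso : Iso U (directSum fun m => interval k N (birth m) (death m))

/-- The bars of an interval decomposition, one for each interval: the origin `(b + 1) / 2` and the
end `d / 2` of the bar are the smallest and the largest `l` such that the interval is nonzero at
`V_l`, that is, an interval which is born at `V_i` and dies at `V_j` or at `W_j` gives the bar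
`(i, j)`. -/
def IntervalDecomposition.barcode {U : ZigzagModule.{u, v} k N} (D : U.IntervalDecomposition) :
    Multiset (ℕ × ℕ) :=
  Finset.univ.val.map fun m => ((D.birth m + 1) / 2, D.death m / 2)

end ZigzagModule

/-! ### `Δ_n`-persistence -/

section Persistence

variable {k : Type u} [Field k] {N : ℕ} (K : ComposableArrows TopCat.{u} N)

/-- The map `f^{i,j}_p : H_p(K_i) → H_p(K_j)` induced by the composition `K_i → ⋯ → K_j`. -/
def filtrationMap (k : Type u) [Field k] (p : ℕ) {i j : Fin (N + 1)} (hij : i ≤ j) :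
    singHomology k p (K.obj i) →ₗ[k] singHomology k p (K.obj j) :=
  singHomologyMap k p (K.map (homOfLE hij))

variable (T : ∀ i, TransferDiagram k (K.obj i))

/-- The `p`-th `Δ_n`-persistent group between `K_i` and `K_j`: the image under `f^{i,j}_p` of
`⋂_{i ≤ l ≤ j} ker (Δ_n ∘ f^{i,l}_p)`. -/
def persistentGroup (n p : ℕ) {i j : Fin (N + 1)} (hij : i ≤ j) :
    Submodule k (singHomology k p (K.obj j)) :=
  Submodule.map (filtrationMap K k p hij)
    (⨅ (l : Fin (N + 1)) (hil : i ≤ l) (_ : l ≤ j),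
      LinearMap.ker ((T l).DeltaDegree n p ∘ₗ filtrationMap K k p hil))

/-- The kernel of `Δ_n` on `H_p(K_l)`. -/
def kernelV (n p : ℕ) (l : Fin (N + 1)) : Submodule k (singHomology k p (K.obj l)) :=
  LinearMap.ker ((T l).DeltaDegree n p)

/-- The classes in `H_p(K_l)` killed by `Δ_n` whose image in `H_p(K_{l+1})` is killed by `Δ_n`. -/
def kernelW (n p : ℕ) (l : Fin N) : Submodule k (singHomology k p (K.obj l.castSucc)) :=
  kernelV K T n p l.castSucc ⊓
    LinearMap.ker
      ((T l.succ).DeltaDegree n p ∘ₗ filtrationMap K k p (Fin.castSucc_lt_succ (i := l)).le)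

/-- The zigzag module of kernels of `Δ_n` in degree `p`: the backward maps are the inclusions
`W_l ⊆ V_l`, and the forward maps `W_l → V_{l+1}` are the restrictions of `f^{l,l+1}_p`. -/
def kernelZigzag (n p : ℕ) : ZigzagModule.{u, u} k N where
  V l := ModuleCat.of k (kernelV K T n p l)
  W l := ModuleCat.of k (kernelW K T n p l)
  backward _ := Submodule.inclusion inf_le_left
  forward l := (filtrationMap K k p (Fin.castSucc_lt_succ (i := l)).le).restrict
    fun _ hx => (Submodule.mem_inf.mp hx).2

end Persistence

end

/-!
The particular nature of the operations `Δ_n` plays no role: the statement holds for the kernels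
of any family of linear maps on the spaces `H_p(K_l)`. What matters is that the zigzag module of
kernels is finite dimensional with injective backward maps, so that it amounts to a sequence of
partially defined linear maps `V_l ⊇ W_l → V_{l+1}`.

Existence of a decomposition. A nonzero vector of the first nonzero space `V_b` is followed to the
right until it leaves the domain `W_l` or is mapped to zero; its images span an interval submodule.
A retraction onto this submodule is built from right to left: a functional at `V_{l+1}` pulls back
to `W_l` and extends to `V_l` (`ZigzagModule.exists_strand`). The kernel of the retraction is a
complement of smaller dimension with injective backward maps, and induction on the dimension gives
finitely many intervals (`ZigzagModule.exists_strands`), in the form of dual bases of all `V_l`.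

The dimension formula. Let `ZigzagModule.reach U i j` be the subspace of `V_j` obtained from `V_i`
by successively taking preimages under the backward maps and images under the forward maps. It is
invariant under isomorphisms, compatible with direct sums, and for an interval born at some `V_l` it
is one-dimensional if the bar contains `[i, j]` and zero otherwise. Injectivity of the backward maps
excludes births at `W_l` (`ZigzagModule.IntervalDecomposition.even_birth`). Hence the dimension of
`reach` is the number of bars that contain `[i, j]`. For the zigzag module of kernels, `reach` is
the persistent group (`mem_persistentGroup_iff_exists_mem_reach`).

Uniqueness of the barcode. By inclusion–exclusion a multiset of bars is determined by the numbers
of its members that contain the various `[i, j]` (`Multiset.eq_of_countP_bars_eq`), and by the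
dimension formula these numbers do not depend on the decomposition.
-/

noncomputable section

/-- A vector outside a subspace is detected by a functional vanishing on the subspace. -/
theorem exists_functional_eq_one {k : Type u} [DivisionRing k] {M : Type v} [AddCommGroup M] [Module k M]
    {p : Submodule k M} {v : M} (hv : v ∉ p) :
    ∃ c : M →ₗ[k] k, c v = 1 ∧ p ≤ LinearMap.ker c := by
  obtain ⟨c, hc, hcv⟩ := LinearMap.exists_extend_of_notMem (0 : p →ₗ[k] k) hv 1
  exact ⟨c, hcv, fun x hx => LinearMap.congr_fun hc ⟨x, hx⟩⟩

namespace ZigzagModule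

variable {k : Type u} [Field k] {N : ℕ}

/-! ### Splitting off one interval -/

/-- An interval summand of a zigzag module, given by spanning vectors and coordinate functionals.
The vectors `vecV l` and `vecW l` span a copy of the interval module `[birth, death]` and vanish
outside it; the functionals `coord l` are the retraction onto this copy at `V_l`, and
`coord l.castSucc ∘ backward l` is the retraction at `W_l`. Only intervals born at some `V_l`
are considered. -/
structure Strand (U : ZigzagModule.{u, v} k N) where
  birth : ℕ
  death : ℕ
  vecV : ∀ l, U.V l
  vecW : ∀ l, U.W l
  coord : ∀ l, U.V l →ₗ[k] k
  birth_even : Even birth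
  birth_le_death : birth ≤ death
  death_le : death ≤ 2 * N
  coord_vecV : ∀ l : Fin (N + 1), birth ≤ 2 * (l : ℕ) ∧ 2 * (l : ℕ) ≤ death →
    coord l (vecV l) = 1
  vecV_eq_zero : ∀ l : Fin (N + 1), ¬(birth ≤ 2 * (l : ℕ) ∧ 2 * (l : ℕ) ≤ death) → vecV l = 0
  coord_eq_zero : ∀ l : Fin (N + 1), ¬(birth ≤ 2 * (l : ℕ) ∧ 2 * (l : ℕ) ≤ death) → coord l = 0
  backward_vecW : ∀ l : Fin N, U.backward l (vecW l) =
    if birth ≤ 2 * (l : ℕ) + 1 ∧ 2 * (l : ℕ) + 1 ≤ death then vecV l.castSucc else 0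
  forward_vecW : ∀ l : Fin N, U.forward l (vecW l) =
    if birth ≤ 2 * (l : ℕ) + 1 ∧ 2 * (l : ℕ) + 1 ≤ death then vecV l.succ else 0
  coord_backward : ∀ (l : Fin N) w, ¬(birth ≤ 2 * (l : ℕ) + 1 ∧ 2 * (l : ℕ) + 1 ≤ death) →
    coord l.castSucc (U.backward l w) = 0
  coord_forward : ∀ (l : Fin N) w, coord l.succ (U.forward l w) =
    if birth ≤ 2 * ((l : ℕ) + 1) ∧ 2 * ((l : ℕ) + 1) ≤ death then
      coord l.castSucc (U.backward l w) else 0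

/-- The zigzag module `V_1 ← W_1 → ⋯ → V_{N+1}` obtained by deleting `V_0` and `W_0`. -/
def tail (U : ZigzagModule.{u, v} k (N + 1)) : ZigzagModule.{u, v} k N where
  V l := U.V l.succ
  W l := U.W l.succ
  backward l := U.backward l.succ
  forward l := U.forward l.succ

/-- A strand of the tail is prolonged to the whole zigzag module by vectors and a functional at
`V_0` and `W_0`. The shift by two positions moves `[b, d]` to `[b + 2, d + 2]`; the prolonged strand
is born at `b'`, which is `b + 2` if it vanishes at `V_0`, and `0` if `b = 0` and it does not. -/
def Strand.cons {U : ZigzagModule.{u, v} k (N + 1)} (S : U.tail.Strand) (b' : ℕ)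
    (v : U.V 0) (w : U.W 0) (c : U.V 0 →ₗ[k] k)
    (h : (b' = S.birth + 2 ∧ v = 0 ∧ w = 0 ∧ c = 0 ∧ ∀ y, S.coord 0 (U.forward 0 y) = 0) ∨
      (b' = 0 ∧ S.birth = 0 ∧ c v = 1 ∧ U.backward 0 w = v ∧ U.forward 0 w = S.vecV 0 ∧
        ∀ y, S.coord 0 (U.forward 0 y) = c (U.backward 0 y))) : U.Strand where
  birth := b'
  death := S.death + 2
  vecV := Fin.cons v S.vecV
  vecW := Fin.cons w S.vecW
  coord := Fin.cons c S.coord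
  birth_even := by
    rcases h with ⟨rfl, -⟩ | ⟨rfl, -⟩
    · exact S.birth_even.add even_two
    · exact Even.zero
  birth_le_death := by have := S.birth_le_death; omega
  death_le := by have := S.death_le; omega
  coord_vecV l hl := by
    cases l using Fin.cases with
    | zero =>
      rcases h with ⟨rfl, -⟩ | ⟨-, -, h, -⟩
      · simp at hl
      · exact h
    | succ l =>
      refine S.coord_vecV l ?_
      rw [Fin.val_succ] at hl
      omega
  vecV_eq_zero l hl := by
    cases l using Fin.cases with
    | zero =>
      rcases h with ⟨-, h, -⟩ | ⟨rfl, -⟩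
      · exact h
      · simp at hl
    | succ l =>
      refine S.vecV_eq_zero l ?_
      rw [Fin.val_succ] at hl
      omega
  coord_eq_zero l hl := by
    cases l using Fin.cases with
    | zero =>
      rcases h with ⟨-, -, -, h, -⟩ | ⟨rfl, -⟩
      · exact h
      · simp at hl
    | succ l =>
      refine S.coord_eq_zero l ?_
      rw [Fin.val_succ] at hl
      omega
  backward_vecW l := by
    cases l using Fin.cases with
    | zero =>
      rcases h with ⟨rfl, -, rfl, -⟩ | ⟨rfl, -, -, h, -⟩
      · rw [if_neg (by simp)]
        exact map_zero _
      · rw [if_pos (by simp)]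
        exact h
    | succ l =>
      refine (S.backward_vecW l).trans (if_congr ?_ rfl rfl)
      rw [Fin.val_succ]
      omega
  forward_vecW l := by
    cases l using Fin.cases with
    | zero =>
      rcases h with ⟨rfl, -, rfl, -⟩ | ⟨rfl, -, -, -, h, -⟩
      · rw [if_neg (by simp)]
        exact map_zero _
      · rw [if_pos (by simp)]
        exact h
    | succ l =>
      refine (S.forward_vecW l).trans (if_congr ?_ rfl rfl)
      rw [Fin.val_succ]
      omega
  coord_backward l y hl := by
    cases l using Fin.cases with
    | zero =>
      rcases h with ⟨-, -, -, rfl, -⟩ | ⟨rfl, -⟩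
      · rfl
      · simp at hl
    | succ l =>
      refine S.coord_backward l y ?_
      rw [Fin.val_succ] at hl
      omega
  coord_forward l y := by
    cases l using Fin.cases with
    | zero =>
      rcases h with ⟨-, -, -, rfl, h⟩ | ⟨rfl, -, -, -, -, h⟩
      · exact (h y).trans (ite_self _).symm
      · rw [if_pos (by simp)]
        exact h y
    | succ l =>
      refine (S.coord_forward l y).trans (if_congr ?_ rfl rfl)
      rw [Fin.val_succ]
      omega

/-- A strand born at `V_0` which dies there or at `W_0`. -/
def Strand.single (U : ZigzagModule.{u, v} k N) (d : ℕ) (hd : d ≤ 1) (hdN : d ≤ 2 * N)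
    (v : U.V 0) (w : ∀ l, U.W l) (c : U.V 0 →ₗ[k] k) (hcv : c v = 1)
    (hb : ∀ l : Fin N, U.backward l (w l) =
      if 2 * (l : ℕ) + 1 ≤ d then Fin.cons (α := fun l => U.V l) v 0 l.castSucc else 0)
    (hf : ∀ l : Fin N, U.forward l (w l) = 0)
    (hc : ∀ (l : Fin N) y, ¬ 2 * (l : ℕ) + 1 ≤ d →
      Fin.cons (α := fun l => U.V l →ₗ[k] k) c 0 l.castSucc (U.backward l y) = 0) :
    U.Strand where
  birth := 0
  death := d
  vecV := Fin.cons (α := fun l => U.V l) v 0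
  vecW := w
  coord := Fin.cons (α := fun l => U.V l →ₗ[k] k) c 0
  birth_even := Even.zero
  birth_le_death := d.zero_le
  death_le := hdN
  coord_vecV l hl := by
    cases l using Fin.cases with
    | zero => exact hcv
    | succ l => rw [Fin.val_succ] at hl; omega
  vecV_eq_zero l hl := by
    cases l using Fin.cases with
    | zero => simp at hl
    | succ l => rfl
  coord_eq_zero l hl := by
    cases l using Fin.cases with
    | zero => simp at hl
    | succ l => rfl
  backward_vecW l := by simpa using hb l
  forward_vecW l := by simpa using hf l
  coord_backward l y hl := hc l y (by simpa using hl)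
  coord_forward l y := by
    rw [if_neg (by omega)]
    rfl

/-- Following a nonzero vector of `V_0` to the right until it leaves the spaces `W_l` or is mapped
to zero gives an interval summand. The functionals are built from right to left: at `V_l` one
extends the pullback to `W_l ⊆ V_l` of the functional already chosen at `V_{l+1}`. -/
theorem exists_strand_of_zero (U : ZigzagModule.{u, v} k N)
    (hU : ∀ l, Function.Injective (U.backward l)) (v : U.V 0) (hv : v ≠ 0) :
    ∃ S : U.Strand, S.birth = 0 ∧ S.vecV 0 = v := by
  induction N with
  | zero =>
    obtain ⟨c, hc, -⟩ := exists_functional_eq_one 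
      (p := (⊥ : Submodule k (U.V 0))) (v := v) (by simpa using hv)
    exact ⟨Strand.single U 0 (by omega) (by omega) v (fun l => l.elim0) c
      hc (fun l => l.elim0) (fun l => l.elim0) (fun l => l.elim0), rfl, rfl⟩
  | succ N ih =>
    -- `v` dies at `V_0`, at `W_0`, or later, according to whether it leaves `W_0`, is killed by
    -- the forward map, or neither
    by_cases hvW : v ∈ LinearMap.range (U.backward 0)
    · obtain ⟨w, rfl⟩ := hvW
      by_cases hw : U.forward 0 w = 0
      · obtain ⟨c, hc, -⟩ := exists_functional_eq_one 
          (p := (⊥ : Submodule k (U.V 0))) (v := U.backward 0 w)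
          (fun h => hv ((Submodule.mem_bot k).mp h))
        refine ⟨Strand.single U 1 le_rfl (by omega) (U.backward 0 w)
          (Fin.cons (α := fun l => U.W l) w 0) c
          hc (fun l => ?_) (fun l => ?_) (fun l y hl => ?_), rfl, rfl⟩
        · cases l using Fin.cases with
          | zero => simp
          | succ l =>
            rw [if_neg (by rw [Fin.val_succ]; omega)]
            exact map_zero _
        · cases l using Fin.cases with
          | zero => exact hw
          | succ l => exact map_zero _
        · cases l using Fin.cases with
          | zero => simp at hl
          | succ l => rfl
      · obtain ⟨S, hS, hSv⟩ := ih U.tail (fun l => hU l.succ) (U.forward 0 w) hw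
        obtain ⟨r, hr⟩ := (U.backward 0).exists_leftInverse_of_injective
          (LinearMap.ker_eq_bot.mpr (hU 0))
        have hr' : ∀ y, r (U.backward 0 y) = y := LinearMap.congr_fun hr
        refine ⟨S.cons 0 (U.backward 0 w) w (S.coord 0 ∘ₗ U.forward 0 ∘ₗ r)
          (Or.inr ⟨rfl, hS, ?_, rfl, hSv.symm, fun y => ?_⟩), rfl, rfl⟩
        · change S.coord 0 (U.forward 0 (r (U.backward 0 w))) = 1
          rw [hr', ← hSv]
          exact S.coord_vecV 0 (by simp [hS])
        · change _ = S.coord 0 (U.forward 0 (r (U.backward 0 y)))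
          rw [hr']
    · obtain ⟨c, hc, hcW⟩ := exists_functional_eq_one (p := LinearMap.range (U.backward 0)) hvW
      refine ⟨Strand.single U 0 (by omega) (by omega) v 0 c
        hc (fun l => ?_) (fun l => map_zero _) (fun l y _ => ?_), rfl, rfl⟩
      · rw [if_neg (by omega)]
        exact map_zero _
      · cases l using Fin.cases with
        | zero => exact hcW (LinearMap.mem_range_self _ y)
        | succ l => rfl

/-- Any nonzero vector of the first nonzero `V_l` starts a strand. It must be the first one: the
forward map into `V_l` then vanishes, as `W_{l-1} ⊆ V_{l-1} = 0`, so it imposes no condition on the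
functional at `V_l`. -/
theorem exists_strand (U : ZigzagModule.{u, v} k N)
    (hU : ∀ l, Function.Injective (U.backward l)) (h : ∃ l, Nontrivial (U.V l)) :
    Nonempty U.Strand := by
  induction N with
  | zero =>
    obtain ⟨l, hl⟩ := h
    obtain rfl : l = 0 := Fin.fin_one_eq_zero l
    obtain ⟨v, hv⟩ := exists_ne (0 : U.V 0)
    exact ⟨(exists_strand_of_zero U hU v hv).choose⟩
  | succ N ih =>
    by_cases h0 : Nontrivial (U.V 0)
    · obtain ⟨v, hv⟩ := exists_ne (0 : U.V 0)
      exact ⟨(exists_strand_of_zero U hU v hv).choose⟩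
    · rw [not_nontrivial_iff_subsingleton] at h0
      obtain ⟨l, hl⟩ := h
      cases l using Fin.cases with
      | zero => exact absurd h0 (not_subsingleton _)
      | succ l =>
        obtain ⟨S⟩ := ih U.tail (fun l => hU l.succ) ⟨l, hl⟩
        refine ⟨S.cons (S.birth + 2) 0 0 0 (Or.inl ⟨rfl, rfl, rfl, rfl, fun y => ?_⟩)⟩
        obtain rfl : y = 0 := hU 0 (h0.elim _ _)
        exact (congrArg (S.coord 0) (map_zero (U.forward 0))).trans (map_zero (S.coord 0))

/-! ### The complement of a strand, and existence of decompositions -/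

namespace Strand

variable {U : ZigzagModule.{u, v} k N} (S : U.Strand)

/-- The complement of a strand: the kernels of the retraction onto it. -/
def compl : ZigzagModule.{u, v} k N where
  V l := ModuleCat.of k (LinearMap.ker (S.coord l))
  W l := ModuleCat.of k (LinearMap.ker (S.coord l.castSucc ∘ₗ U.backward l))
  backward l := (U.backward l).restrict fun _ hw => hw
  forward l := (U.forward l).restrict fun w hw => by
    rw [LinearMap.mem_ker] at hw ⊢
    rw [S.coord_forward]
    split_ifs
    · exact hw
    · rfl

/-- The projection `v ↦ v - coord v • vec` onto the complement at `V_l`. -/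
def projV (l : Fin (N + 1)) : U.V l →ₗ[k] S.compl.V l :=
  LinearMap.codRestrict _ (LinearMap.id - (S.coord l).smulRight (S.vecV l)) fun v => by
    by_cases hl : S.birth ≤ 2 * (l : ℕ) ∧ 2 * (l : ℕ) ≤ S.death
    · simp [S.coord_vecV l hl]
    · simp [S.coord_eq_zero l hl]

theorem val_projV (l : Fin (N + 1)) (v : U.V l) :
    (S.projV l v).1 = v - S.coord l v • S.vecV l := rfl

theorem projV_of_coord_eq_zero (l : Fin (N + 1)) (v : U.V l) (hv : S.coord l v = 0) :
    S.projV l v = ⟨v, hv⟩ := Subtype.ext (by rw [val_projV, hv, zero_smul, sub_zero])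

theorem projV_vecV (l : Fin (N + 1)) : S.projV l (S.vecV l) = 0 := by
  refine Subtype.ext ?_
  rw [val_projV]
  by_cases hl : S.birth ≤ 2 * (l : ℕ) ∧ 2 * (l : ℕ) ≤ S.death
  · rw [S.coord_vecV l hl, one_smul, sub_self]; rfl
  · rw [S.vecV_eq_zero l hl, smul_zero, sub_zero]; rfl

/-- The projections onto the complement are compatible with the structure maps; on `W_l` the
projection is `w ↦ w - coord (backward w) • vecW`. -/
theorem exists_projW (l : Fin N) (w : U.W l) : ∃ w' : S.compl.W l,
    S.compl.backward l w' = S.projV l.castSucc (U.backward l w) ∧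
      S.compl.forward l w' = S.projV l.succ (U.forward l w) := by
  have hb : U.backward l (w - S.coord l.castSucc (U.backward l w) • S.vecW l) =
      (S.projV l.castSucc (U.backward l w)).1 := by
    rw [val_projV, map_sub, map_smul, S.backward_vecW]
    split_ifs with h
    · rfl
    · rw [S.coord_backward l w h, zero_smul, zero_smul]
  refine ⟨⟨w - S.coord l.castSucc (U.backward l w) • S.vecW l, ?_⟩, Subtype.ext hb,
    Subtype.ext ?_⟩
  · rw [LinearMap.mem_ker, LinearMap.comp_apply, hb]
    exact (S.projV l.castSucc (U.backward l w)).2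
  · change U.forward l (w - S.coord l.castSucc (U.backward l w) • S.vecW l) = _
    rw [val_projV, map_sub, map_smul, S.forward_vecW, S.coord_forward]
    split_ifs with h h' h'
    · rfl
    · rw [S.vecV_eq_zero l.succ h', smul_zero, smul_zero]
    · rw [S.coord_backward l w h, zero_smul, zero_smul]
    · rw [smul_zero, zero_smul]

/-- A strand of the complement is a strand of the whole zigzag module. -/
def ofCompl (S' : S.compl.Strand) : U.Strand where
  birth := S'.birth
  death := S'.death
  vecV l := (S'.vecV l).1
  vecW l := (S'.vecW l).1
  coord l := S'.coord l ∘ₗ S.projV l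
  birth_even := S'.birth_even
  birth_le_death := S'.birth_le_death
  death_le := S'.death_le
  coord_vecV l hl := by
    rw [LinearMap.comp_apply, S.projV_of_coord_eq_zero l _ (S'.vecV l).2]
    exact S'.coord_vecV l hl
  vecV_eq_zero l hl := congrArg Subtype.val (S'.vecV_eq_zero l hl)
  coord_eq_zero l hl := by rw [S'.coord_eq_zero l hl, LinearMap.zero_comp]
  backward_vecW l := (congrArg Subtype.val (S'.backward_vecW l)).trans (by split_ifs <;> rfl)
  forward_vecW l := (congrArg Subtype.val (S'.forward_vecW l)).trans (by split_ifs <;> rfl)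
  coord_backward l w hl := by
    obtain ⟨w', hb, -⟩ := S.exists_projW l w
    rw [LinearMap.comp_apply, ← hb]
    exact S'.coord_backward l w' hl
  coord_forward l w := by
    obtain ⟨w', hb, hf⟩ := S.exists_projW l w
    rw [LinearMap.comp_apply, LinearMap.comp_apply, ← hb, ← hf]
    exact S'.coord_forward l w'

end Strand

/-- A finite-dimensional zigzag module with injective backward maps has, at every `V_l`, a basis
consisting of the vectors of finitely many strands which are dual to each other. -/
theorem exists_strands (U : ZigzagModule.{u, v} k N)
    (hU : ∀ l, Function.Injective (U.backward l)) (hfin : ∀ l, FiniteDimensional k (U.V l)) :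
    ∃ (n : ℕ) (S : Fin n → U.Strand),
      (∀ m m' l, m ≠ m' → (S m).coord l ((S m').vecV l) = 0) ∧
      ∀ l v, ∑ m, (S m).coord l v • (S m).vecV l = v := by
  obtain ⟨D, hD⟩ : ∃ D, ∑ l, Module.finrank k (U.V l) = D := ⟨_, rfl⟩
  induction D using Nat.strong_induction_on generalizing U with
  | _ D ih =>
  by_cases h : ∃ l, Nontrivial (U.V l)
  · obtain ⟨S⟩ := exists_strand U hU h
    have hfin' : ∀ l, FiniteDimensional k (S.compl.V l) := fun l =>
      inferInstanceAs (FiniteDimensional k (LinearMap.ker (S.coord l)))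
    obtain ⟨n, T, hT, hT'⟩ := ih _ (by
      rw [← hD]
      refine Finset.sum_lt_sum (fun l _ => Submodule.finrank_le (LinearMap.ker (S.coord l))) ?_
      obtain ⟨a, ha⟩ := S.birth_even
      have h1 := S.birth_le_death
      have h2 := S.death_le
      refine ⟨⟨a, by omega⟩, Finset.mem_univ _, Submodule.finrank_lt fun htop => ?_⟩
      have h3 := S.coord_vecV ⟨a, by omega⟩ (by simp only; omega)
      rw [LinearMap.ker_eq_top.mp htop] at h3
      exact zero_ne_one h3) S.compl
      (fun l x y hxy => Subtype.ext (hU l (congrArg Subtype.val hxy))) hfin' rfl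
    refine ⟨n + 1, Fin.cons S fun m => S.ofCompl (T m), fun m m' l hm => ?_, fun l v => ?_⟩
    · cases m using Fin.cases with
      | zero =>
        cases m' using Fin.cases with
        | zero => exact absurd rfl hm
        | succ m' => exact ((T m').vecV l).2
      | succ m =>
        cases m' using Fin.cases with
        | zero =>
          change (T m).coord l (S.projV l (S.vecV l)) = 0
          rw [S.projV_vecV, map_zero]
        | succ m' =>
          change (T m).coord l (S.projV l ((T m').vecV l).1) = 0
          rw [S.projV_of_coord_eq_zero l _ ((T m').vecV l).2]
          exact hT m m' l fun h => hm (congrArg Fin.succ h)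
    · have h1 := congrArg (LinearMap.ker (S.coord l)).subtype (hT' l (S.projV l v))
      replace h1 := (map_sum (LinearMap.ker (S.coord l)).subtype _ _).symm.trans h1
      rw [Fin.sum_univ_succ]
      change S.coord l v • S.vecV l + ∑ m, (LinearMap.ker (S.coord l)).subtype
        ((T m).coord l (S.projV l v) • (T m).vecV l) = v
      rw [h1]
      change _ + (S.projV l v).1 = v
      rw [S.val_projV, add_sub_cancel]
  · refine ⟨0, fun m => m.elim0, fun m => m.elim0, fun l v => ?_⟩
    have : Subsingleton (U.V l) := not_nontrivial_iff_subsingleton.mp fun hl => h ⟨l, hl⟩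
    exact Subsingleton.elim _ _

theorem linearEquivFunOnFintype_symm_apply {ι : Type} [Fintype ι] (M : ι → Type v)
    [∀ m, AddCommGroup (M m)] [∀ m, Module k (M m)] (f : ∀ m, M m) (m : ι) :
    (DirectSum.linearEquivFunOnFintype k ι M).symm f m = f m :=
  congrFun ((DirectSum.linearEquivFunOnFintype k ι M).apply_symm_apply f) m

/-- Vectors `e m` and functionals `c m` dual to each other, with `c m` taking values in `p m` and
`e m` irrelevant when `p m = 0`, identify a space with `⨁ m, p m`. -/
theorem exists_equiv_of_dual {M : Type v} [AddCommGroup M] [Module k M] {n : ℕ}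
    (p : Fin n → Submodule k k) (c : Fin n → M →ₗ[k] k) (e : Fin n → M) (hp : ∀ m v, c m v ∈ p m)
    (h1 : ∀ m, ∀ a ∈ p m, a * c m (e m) = a) (h0 : ∀ m m', m ≠ m' → c m (e m') = 0)
    (hs : ∀ v, ∑ m, c m v • e m = v) :
    ∃ f : M ≃ₗ[k] ⨁ m, p m, ∀ v m, (f v m : k) = c m v := by
  let g : M →ₗ[k] ⨁ m, p m := (DirectSum.linearEquivFunOnFintype k (Fin n) fun m => p m).symm ∘ₗ
    LinearMap.pi fun m => (c m).codRestrict (p m) (hp m)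
  have hg : ∀ v m, (g v m : k) = c m v := fun v m =>
    congrArg Subtype.val (linearEquivFunOnFintype_symm_apply (k := k) (fun m => p m) _ m)
  refine ⟨LinearEquiv.ofBijective g ⟨fun v v' h => ?_, fun a => ⟨∑ m, (a m : k) • e m, ?_⟩⟩, hg⟩
  · rw [← hs v, ← hs v']
    exact Finset.sum_congr rfl fun m _ => by rw [← hg, ← hg, h]
  · refine DFinsupp.ext fun m => Subtype.ext ?_
    rw [hg, map_sum, Finset.sum_eq_single m
      (fun m' _ hm => by rw [map_smul, h0 m m' hm.symm, smul_zero])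
      (fun h => absurd (Finset.mem_univ m) h), map_smul, smul_eq_mul, h1 m _ (a m).2]

theorem mem_intervalSpace {b d t : ℕ} {a : k} :
    a ∈ intervalSpace k b d t ↔ (b ≤ t ∧ t ≤ d) ∨ a = 0 := by
  unfold intervalSpace
  split_ifs with h <;> simp [h]

theorem val_intervalMap (b d t t' : ℕ) (a : intervalSpace k b d t) :
    (intervalMap k b d t t' a : k) = if b ≤ t' ∧ t' ≤ d then (a : k) else 0 := by
  unfold intervalMap
  split_ifs with h <;> rfl

theorem nonempty_intervalDecomposition (U : ZigzagModule.{u, v} k N)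
    (hU : ∀ l, Function.Injective (U.backward l)) (hfin : ∀ l, FiniteDimensional k (U.V l)) :
    Nonempty U.IntervalDecomposition := by
  obtain ⟨n, S, h0, hs⟩ := exists_strands U hU hfin
  -- by injectivity of the backward maps, the expansion at `W_l` is inherited from `V_l`
  have hsW : ∀ l w, ∑ m, (S m).coord l.castSucc (U.backward l w) • (S m).vecW l = w := by
    intro l w
    refine hU l ?_
    rw [map_sum]
    refine Eq.trans (Finset.sum_congr rfl fun m _ => ?_) (hs l.castSucc (U.backward l w))
    rw [map_smul, (S m).backward_vecW]
    split_ifs with h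
    · rfl
    · rw [(S m).coord_backward l w h, zero_smul, zero_smul]
  have hV : ∀ l, ∃ f : U.V l ≃ₗ[k]
      ⨁ m, intervalSpace k (S m).birth (S m).death (2 * (l : ℕ)),
      ∀ v m, (f v m : k) = (S m).coord l v := by
    refine fun l => exists_equiv_of_dual _ (fun m => (S m).coord l) (fun m => (S m).vecV l)
      (fun m v => ?_) (fun m a ha => ?_) (fun m m' hm => h0 m m' l hm) (hs l)
    · rw [mem_intervalSpace, or_iff_not_imp_left]
      intro h
      rw [(S m).coord_eq_zero l h]
      rfl
    · rcases mem_intervalSpace.mp ha with h | rfl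
      · rw [(S m).coord_vecV l h, mul_one]
      · rw [zero_mul]
  have hW : ∀ l, ∃ f : U.W l ≃ₗ[k]
      ⨁ m, intervalSpace k (S m).birth (S m).death (2 * (l : ℕ) + 1),
      ∀ w m, (f w m : k) = (S m).coord l.castSucc (U.backward l w) := by
    refine fun l => exists_equiv_of_dual _ (fun m => (S m).coord l.castSucc ∘ₗ U.backward l)
      (fun m => (S m).vecW l) (fun m w => ?_) (fun m a ha => ?_) (fun m m' hm => ?_) (hsW l)
    · rw [mem_intervalSpace, or_iff_not_imp_left]
      exact (S m).coord_backward l w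
    · rcases mem_intervalSpace.mp ha with h | rfl
      · rw [LinearMap.comp_apply, (S m).backward_vecW, if_pos h, (S m).coord_vecV, mul_one]
        obtain ⟨c, hc⟩ := (S m).birth_even
        rw [Fin.val_castSucc]
        omega
      · rw [zero_mul]
    · rw [LinearMap.comp_apply, (S m').backward_vecW]
      split_ifs
      · exact h0 m m' _ hm
      · exact map_zero _
  choose eV heV using hV
  choose eW heW using hW
  refine ⟨{
    size := n
    birth := fun m => (S m).birth
    death := fun m => (S m).death
    birth_le_death := fun m => (S m).birth_le_death
    death_le := fun m => (S m).death_le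
    iso := {
      equivV := eV
      equivW := eW
      comm_backward := fun l w => DFinsupp.ext fun m => Subtype.ext ?_
      comm_forward := fun l w => DFinsupp.ext fun m => Subtype.ext ?_ } }⟩
  · refine (heV _ _ _).trans (Eq.trans ?_ (val_intervalMap _ _ _ _ (eW l w m)).symm)
    rw [heW]
    split_ifs with h
    · rfl
    · rw [(S m).coord_eq_zero l.castSucc h]
      rfl
  · refine (heV _ _ _).trans (Eq.trans ?_ (val_intervalMap _ _ _ _ (eW l w m)).symm)
    rw [heW]
    exact (S m).coord_forward l w

/-! ### The subspaces of vectors that survive from one position to another -/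

/-- Induction on `j ≥ i` in `Fin (N + 1)`. -/
theorem _root_.Fin.le_castSucc_induction {i : Fin (N + 1)} {P : ∀ j, i ≤ j → Prop}
    (refl : P i le_rfl)
    (step : ∀ (l : Fin N) (h : i ≤ l.castSucc), P l.castSucc h →
      P l.succ (h.trans Fin.castSucc_lt_succ.le))
    (j : Fin (N + 1)) (hij : i ≤ j) : P j hij := by
  induction j using Fin.induction with
  | zero =>
    obtain rfl : i = 0 := Fin.le_zero_iff.mp hij
    exact refl
  | succ l ih =>
    rcases hij.eq_or_lt with rfl | h
    · exact refl
    · exact step l (Fin.le_castSucc_iff.mpr h) (ih _)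

/-- The vectors of `V_l` that are reached from `V_i`: those `x_l` for which there are
`w_i, …, w_{l-1}` in `W_i, …, W_{l-1}` such that `w_{t-1}` and `w_t` have the same image in `V_t`
for `i < t < l` and `w_{l-1} ↦ x_l`. The value is `V_l` for `l ≤ i`. -/
def reach (U : ZigzagModule.{u, v} k N) (i : Fin (N + 1)) : ∀ l, Submodule k (U.V l) :=
  Fin.induction ⊤ fun l S => if l.succ ≤ i then ⊤ else (S.comap (U.backward l)).map (U.forward l)

theorem reach_self (U : ZigzagModule.{u, v} k N) (i : Fin (N + 1)) : U.reach i i = ⊤ := by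
  cases i using Fin.cases with
  | zero => rfl
  | succ i => exact (Fin.induction_succ _ _ _).trans (if_pos le_rfl)

theorem reach_succ (U : ZigzagModule.{u, v} k N) {i : Fin (N + 1)} {l : Fin N}
    (h : i ≤ l.castSucc) : U.reach i l.succ =
      ((U.reach i l.castSucc).comap (U.backward l)).map (U.forward l) :=
  (Fin.induction_succ _ _ _).trans (if_neg (h.trans_lt Fin.castSucc_lt_succ).not_ge)

theorem mem_reach_succ (U : ZigzagModule.{u, v} k N) {i : Fin (N + 1)} {l : Fin N}
    (h : i ≤ l.castSucc) (x : U.V l.succ) : x ∈ U.reach i l.succ ↔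
      ∃ w, U.backward l w ∈ U.reach i l.castSucc ∧ U.forward l w = x := by
  rw [reach_succ U h]
  rfl

theorem Iso.mem_reach_iff {U : ZigzagModule.{u, v} k N} {U' : ZigzagModule.{u, w} k N}
    (e : Iso U U') {i j : Fin (N + 1)} (hij : i ≤ j) (x : U.V j) :
    e.equivV j x ∈ U'.reach i j ↔ x ∈ U.reach i j := by
  induction j, hij using Fin.le_castSucc_induction with
  | refl => simp [reach_self]
  | step l h ih =>
    rw [mem_reach_succ _ h, mem_reach_succ _ h]
    constructor
    · rintro ⟨w', hb, hf⟩
      obtain ⟨w, rfl⟩ := (e.equivW l).surjective w'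
      rw [← e.comm_backward, ih] at hb
      rw [← e.comm_forward] at hf
      exact ⟨w, hb, (e.equivV l.succ).injective hf⟩
    · rintro ⟨w, hb, rfl⟩
      exact ⟨e.equivW l w, by rwa [← e.comm_backward, ih], (e.comm_forward l w).symm⟩

theorem mem_reach_directSum_iff {ι : Type} [Fintype ι] (U : ι → ZigzagModule.{u, v} k N)
    {i j : Fin (N + 1)} (hij : i ≤ j) (x : ⨁ m, (U m).V j) :
    x ∈ (directSum U).reach i j ↔ ∀ m, x m ∈ (U m).reach i j := by
  classical
  induction j, hij using Fin.le_castSucc_induction with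
  | refl =>
    rw [reach_self]
    exact iff_of_true trivial fun m => by rw [reach_self]; trivial
  | step l h ih =>
    simp_rw [mem_reach_succ (U _) h]
    refine (mem_reach_succ (directSum U) h x).trans ?_
    constructor
    · rintro ⟨w, hb, rfl⟩ m
      exact ⟨DirectSum.component k ι (fun m => (U m).W l) m w, (ih _).mp hb m, rfl⟩
    · intro hx
      choose w hb hf using hx
      let w' : ⨁ m, (U m).W l := (DirectSum.linearEquivFunOnFintype k ι fun m => (U m).W l).symm w
      have hw' : ∀ m, w' m = w m := linearEquivFunOnFintype_symm_apply (k := k) _ w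
      refine ⟨w', (ih _).mpr fun m => ?_, DFinsupp.ext fun m => ?_⟩
      · change (U m).backward l (w' m) ∈ _
        rw [hw']
        exact hb m
      · change (U m).forward l (w' m) = _
        rw [hw']
        exact hf m

/-- For an even birth `b`, the backward maps of the interval module are injective, so nothing is
reached from a `V_i` that precedes the birth. -/
theorem mem_reach_interval_iff {b d : ℕ} (hb : Even b) {i j : Fin (N + 1)} (hij : i ≤ j)
    (x : intervalSpace k b d (2 * (j : ℕ))) :
    x ∈ (interval k N b d).reach i j ↔ (b ≤ 2 * (i : ℕ) ∧ 2 * (j : ℕ) ≤ d) ∨ (x : k) = 0 := by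
  induction j, hij using Fin.le_castSucc_induction with
  | refl =>
    rw [reach_self]
    exact iff_of_true trivial (mem_intervalSpace.mp x.2)
  | step l h ih =>
    refine (mem_reach_succ (interval k N b d) h x).trans ?_
    have hil : (i : ℕ) ≤ l := h
    constructor
    · rintro ⟨w, hw, rfl⟩
      have hv := val_intervalMap b d _ (2 * ((l.succ : Fin (N + 1)) : ℕ)) w
      rw [or_iff_not_imp_right]
      intro hx
      change (intervalMap k b d (2 * (l : ℕ) + 1) (2 * ((l.succ : Fin (N + 1)) : ℕ)) w : k) ≠ 0
        at hx
      rw [hv, ite_ne_right_iff] at hx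
      obtain ⟨⟨-, hd⟩, hw0⟩ := hx
      have hb' := ((mem_intervalSpace.mp w.2).resolve_right hw0).1
      obtain ⟨c, rfl⟩ := hb
      rw [Fin.val_succ] at hd ⊢
      have h2 := (ih _).mp hw
      have hv' := val_intervalMap (c + c) d _ (2 * ((l.castSucc : Fin (N + 1)) : ℕ)) w
      rw [if_pos (by rw [Fin.val_castSucc]; omega)] at hv'
      exact ⟨(h2.resolve_right fun h3 => hw0 (hv'.symm.trans h3)).1, hd⟩
    · rintro (⟨h1, h2⟩ | hx)
      · rw [Fin.val_succ] at h2
        refine ⟨⟨x.1, mem_intervalSpace.mpr (Or.inl (by omega))⟩, (ih _).mpr (Or.inl ?_),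
          Subtype.ext ?_⟩
        · rw [Fin.val_castSucc]
          omega
        · refine (val_intervalMap _ _ _ _ _).trans (if_pos ?_)
          rw [Fin.val_succ]
          omega
      · obtain rfl : x = 0 := Subtype.ext hx
        exact ⟨0, by rw [map_zero]; exact zero_mem _, map_zero _⟩

theorem finrank_reach_interval {b d : ℕ} (hb : Even b) {i j : Fin (N + 1)} (hij : i ≤ j) :
    Module.finrank k ((interval k N b d).reach i j) =
      if b ≤ 2 * (i : ℕ) ∧ 2 * (j : ℕ) ≤ d then 1 else 0 := by
  have hij' : (i : ℕ) ≤ j := hij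
  split_ifs with h
  · have h1 : (interval k N b d).reach i j = ⊤ := eq_top_iff.mpr fun x _ =>
      (mem_reach_interval_iff hb hij x).mpr (Or.inl h)
    rw [h1, finrank_top]
    change Module.finrank k (intervalSpace k b d (2 * (j : ℕ))) = 1
    rw [intervalSpace, if_pos (by omega), finrank_top, Module.finrank_self]
  · have h1 : (interval k N b d).reach i j = ⊥ := eq_bot_iff.mpr fun x hx =>
      Subtype.ext (((mem_reach_interval_iff hb hij x).mp hx).resolve_left h)
    rw [h1, finrank_bot]

theorem finrank_reach_directSum {ι : Type} [Fintype ι] (U : ι → ZigzagModule.{u, v} k N)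
    {i j : Fin (N + 1)} (hij : i ≤ j) (hfin : ∀ m, FiniteDimensional k ((U m).V j)) :
    Module.finrank k ((directSum U).reach i j) = ∑ m, Module.finrank k ((U m).reach i j) := by
  classical
  have e : (directSum U).reach i j ≃ₗ[k] ∀ m, (U m).reach i j :=
    LinearEquiv.ofBijective
      (LinearMap.pi fun m => LinearMap.codRestrict ((U m).reach i j)
        (DirectSum.component k ι (fun m => (U m).V j) m ∘ₗ ((directSum U).reach i j).subtype)
        fun x => (mem_reach_directSum_iff U hij x.1).mp x.2 m)
      ⟨fun x y hxy => Subtype.ext (DFinsupp.ext fun m => congrArg Subtype.val (congrFun hxy m)),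
        fun y => ⟨⟨(DirectSum.linearEquivFunOnFintype k ι fun m => (U m).V j).symm fun m => (y m).1,
          (mem_reach_directSum_iff U hij _).mpr fun m => by
            rw [linearEquivFunOnFintype_symm_apply]
            exact (y m).2⟩,
          funext fun m => Subtype.ext (linearEquivFunOnFintype_symm_apply (k := k)
            (fun m => (U m).V j) (fun m => (y m).1) m)⟩⟩
  rw [e.finrank_eq, Module.finrank_pi_fintype]

/-- Since `reach` is invariant under isomorphisms and additive, its dimension counts the intervals
on which it is nonzero. -/
theorem IntervalDecomposition.finrank_reach {U : ZigzagModule.{u, v} k N}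
    (D : U.IntervalDecomposition) (hD : ∀ m, Even (D.birth m)) {i j : Fin (N + 1)} (hij : i ≤ j) :
    Module.finrank k (U.reach i j) =
      D.barcode.countP fun β => β.1 ≤ (i : ℕ) ∧ (j : ℕ) ≤ β.2 := by
  have h1 : (U.reach i j).map (D.iso.equivV j).toLinearMap =
      (directSum fun m => interval k N (D.birth m) (D.death m)).reach i j := by
    ext x
    obtain ⟨y, rfl⟩ := (D.iso.equivV j).surjective x
    rw [D.iso.mem_reach_iff hij, Submodule.mem_map]
    exact ⟨fun ⟨z, hz, hzy⟩ => (D.iso.equivV j).injective hzy ▸ hz, fun h => ⟨y, h, rfl⟩⟩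
  rw [← LinearEquiv.finrank_map_eq (D.iso.equivV j), h1, finrank_reach_directSum _ hij (fun m =>
    inferInstanceAs (FiniteDimensional k (intervalSpace k (D.birth m) (D.death m) (2 * (j : ℕ)))))]
  simp_rw [finrank_reach_interval (hD _) hij]
  rw [Finset.sum_boole, barcode, Multiset.countP_map, Nat.cast_id, Finset.card, Finset.filter_val]
  congr 1
  refine Multiset.filter_congr fun m _ => ?_
  omega

/-! ### Births and uniqueness of the barcode -/

/-- An interval born at `W_l` would be in the kernel of the backward map at `l`. -/
theorem IntervalDecomposition.even_birth {U : ZigzagModule.{u, v} k N}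
    (D : U.IntervalDecomposition) (hU : ∀ l, Function.Injective (U.backward l)) (m : Fin D.size) :
    Even (D.birth m) := by
  by_contra hm
  obtain ⟨c, hc⟩ := Nat.not_even_iff_odd.mp hm
  have h1 := D.birth_le_death m
  have h2 := D.death_le m
  let l : Fin N := ⟨c, by omega⟩
  let a : intervalSpace k (D.birth m) (D.death m) (2 * (l : ℕ) + 1) :=
    ⟨1, mem_intervalSpace.mpr (Or.inl (by simp only [l]; omega))⟩
  let y : (directSum fun m => interval k N (D.birth m) (D.death m)).W l :=
    DirectSum.lof k (Fin D.size)
      (fun m => intervalSpace k (D.birth m) (D.death m) (2 * (l : ℕ) + 1)) m a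
  have hy : (directSum fun m => interval k N (D.birth m) (D.death m)).backward l y = 0 := by
    refine (DirectSum.lmap_lof _ _ _).trans ?_
    have : intervalMap k (D.birth m) (D.death m) (2 * (l : ℕ) + 1) (2 * (l : ℕ)) a = 0 :=
      Subtype.ext ((val_intervalMap _ _ _ _ _).trans (if_neg (by simp only [l]; omega)))
    exact (congrArg _ this).trans (map_zero _)
  obtain ⟨w, hw⟩ := (D.iso.equivW l).surjective y
  rw [← hw, ← D.iso.comm_backward, LinearEquiv.map_eq_zero_iff] at hy
  have hw0 : w = 0 := hU l (hy.trans (map_zero _).symm)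
  rw [hw0, map_zero] at hw
  have h3 := congrArg (fun z : ⨁ m, intervalSpace k (D.birth m) (D.death m) (2 * (l : ℕ) + 1) =>
    (z m : k)) hw
  have h4 : (DirectSum.lof k (Fin D.size)
      (fun m => intervalSpace k (D.birth m) (D.death m) (2 * (l : ℕ) + 1)) m a) m = a :=
    DirectSum.lof_apply (M := fun m => intervalSpace k (D.birth m) (D.death m) (2 * (l : ℕ) + 1))
      k m a
  exact zero_ne_one (h3.trans (congrArg Subtype.val h4))

/-- Inclusion–exclusion: the multiplicity of the bar `(a, b)` in terms of the numbers of bars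
that contain an interval. -/
theorem _root_.Multiset.count_add_countP_bars (M : Multiset (ℕ × ℕ)) (a b : ℕ) :
    M.count (a, b) + M.countP (fun β => β.1 < a ∧ b ≤ β.2) +
        M.countP (fun β => β.1 < a + 1 ∧ b + 1 ≤ β.2) =
      M.countP (fun β => β.1 < a + 1 ∧ b ≤ β.2) + M.countP (fun β => β.1 < a ∧ b + 1 ≤ β.2) := by
  induction M using Multiset.induction_on with
  | empty => rfl
  | cons β M ih =>
    obtain ⟨c, d⟩ := β
    simp only [Multiset.count_cons, Multiset.countP_cons, Prod.mk.injEq]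
    split_ifs <;> omega

/-- A finite multiset of bars in `[0, N]` is determined by the numbers of bars that contain the
intervals `[i, j] ⊆ [0, N]`. -/
theorem _root_.Multiset.eq_of_countP_bars_eq {N : ℕ} {M M' : Multiset (ℕ × ℕ)}
    (hM : ∀ β ∈ M, β.1 ≤ β.2 ∧ β.2 ≤ N) (hM' : ∀ β ∈ M', β.1 ≤ β.2 ∧ β.2 ≤ N)
    (h : ∀ i j, i ≤ j → j ≤ N → M.countP (fun β => β.1 ≤ i ∧ j ≤ β.2) =
      M'.countP (fun β => β.1 ≤ i ∧ j ≤ β.2)) : M = M' := by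
  have key : ∀ i j, i ≤ j + 1 → M.countP (fun β => β.1 < i ∧ j ≤ β.2) =
      M'.countP (fun β => β.1 < i ∧ j ≤ β.2) := by
    intro i j hij
    by_cases hj : j ≤ N
    · cases i with
      | zero => simp
      | succ i =>
        simp_rw [Nat.lt_succ_iff]
        exact h i j (by omega) hj
    · rw [Multiset.countP_eq_zero.mpr, Multiset.countP_eq_zero.mpr]
      · intro β hβ h2
        have := hM' β hβ
        omega
      · intro β hβ h2
        have := hM β hβ
        omega
  ext ⟨a, b⟩
  by_cases hab : a ≤ b
  · have h1 := M.count_add_countP_bars a b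
    have h2 := M'.count_add_countP_bars a b
    rw [key a b (by omega), key (a + 1) (b + 1) (by omega), key (a + 1) b (by omega),
      key a (b + 1) (by omega)] at h1
    omega
  -- a pair `(a, b)` with `b < a` belongs to neither multiset
  · rw [Multiset.count_eq_zero.mpr fun h => hab (hM _ h).1,
      Multiset.count_eq_zero.mpr fun h => hab (hM' _ h).1]

theorem IntervalDecomposition.mem_barcode {U : ZigzagModule.{u, v} k N}
    (D : U.IntervalDecomposition) (hD : ∀ m, Even (D.birth m)) :
    ∀ β ∈ D.barcode, β.1 ≤ β.2 ∧ β.2 ≤ N := by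
  intro β hβ
  obtain ⟨m, -, rfl⟩ := Multiset.mem_map.mp hβ
  have h1 := D.birth_le_death m
  have h2 := D.death_le m
  obtain ⟨c, hc⟩ := hD m
  dsimp only
  omega

theorem IntervalDecomposition.barcode_eq {U : ZigzagModule.{u, v} k N}
    (hU : ∀ l, Function.Injective (U.backward l)) (D D' : U.IntervalDecomposition) :
    D.barcode = D'.barcode := by
  refine Multiset.eq_of_countP_bars_eq (D.mem_barcode (D.even_birth hU))
    (D'.mem_barcode (D'.even_birth hU)) fun i j hij hj => ?_
  have hij' : (⟨i, by omega⟩ : Fin (N + 1)) ≤ ⟨j, by omega⟩ := hij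
  exact (D.finrank_reach (D.even_birth hU) hij').symm.trans
    (D'.finrank_reach (D'.even_birth hU) hij')

end ZigzagModule

/-! ### The persistent groups as subspaces of reached vectors -/

section Persistence

variable {k : Type u} [Field k] {N : ℕ} (K : ComposableArrows TopCat.{u} N)

theorem filtrationMap_self (p : ℕ) (i : Fin (N + 1)) (x : singHomology k p (K.obj i)) :
    filtrationMap K k p (le_refl i) x = x := by
  have h : K.map (homOfLE (le_refl i)) = 𝟙 _ := K.map_id i
  unfold filtrationMap singHomologyMap
  rw [h, CategoryTheory.Functor.map_id]
  rfl

theorem filtrationMap_trans (p : ℕ) {i j l : Fin (N + 1)} (hij : i ≤ j) (hjl : j ≤ l)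
    (x : singHomology k p (K.obj i)) :
    filtrationMap K k p hjl (filtrationMap K k p hij x) = filtrationMap K k p (hij.trans hjl) x := by
  have h : K.map (homOfLE (hij.trans hjl)) = K.map (homOfLE hij) ≫ K.map (homOfLE hjl) :=
    K.map_comp (homOfLE hij) (homOfLE hjl)
  unfold filtrationMap singHomologyMap
  rw [h, Functor.map_comp]
  rfl

variable (T : ∀ i, TransferDiagram k (K.obj i))

theorem mem_persistentGroup {n p : ℕ} {i j : Fin (N + 1)} (hij : i ≤ j)
    (x : singHomology k p (K.obj j)) : x ∈ persistentGroup K T n p hij ↔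
      ∃ z, (∀ (l : Fin (N + 1)) (hil : i ≤ l), l ≤ j →
        filtrationMap K k p hil z ∈ kernelV K T n p l) ∧ filtrationMap K k p hij z = x := by
  simp only [persistentGroup, Submodule.mem_map, Submodule.mem_iInf]
  rfl

theorem mem_persistentGroup_succ {n p : ℕ} {i : Fin (N + 1)} {l : Fin N} (h : i ≤ l.castSucc)
    (x : singHomology k p (K.obj l.succ)) :
    x ∈ persistentGroup K T n p (h.trans Fin.castSucc_lt_succ.le) ↔
      ∃ y ∈ persistentGroup K T n p h,
        filtrationMap K k p (Fin.castSucc_lt_succ (i := l)).le y = x ∧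
          x ∈ kernelV K T n p l.succ := by
  simp only [mem_persistentGroup]
  constructor
  · rintro ⟨z, hz, rfl⟩
    exact ⟨_, ⟨z, fun t ht htl => hz t ht (htl.trans Fin.castSucc_lt_succ.le), rfl⟩,
      filtrationMap_trans K p _ _ z, hz _ _ le_rfl⟩
  · rintro ⟨_, ⟨z, hz, rfl⟩, rfl, hx⟩
    rw [filtrationMap_trans] at hx ⊢
    refine ⟨z, fun t ht htl => ?_, rfl⟩
    rcases htl.eq_or_lt with rfl | htl
    · exact hx
    · exact hz t ht (Fin.le_castSucc_iff.mpr htl)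

/-- The persistent group between `K_i` and `K_j` consists of the elements of `V_j = ker Δ_n` that
are reached from `V_i` in the zigzag module of kernels. -/
theorem mem_persistentGroup_iff_exists_mem_reach {n p : ℕ} {i j : Fin (N + 1)} (hij : i ≤ j)
    (x : singHomology k p (K.obj j)) : x ∈ persistentGroup K T n p hij ↔
      ∃ hx : x ∈ kernelV K T n p j,
        (⟨x, hx⟩ : kernelV K T n p j) ∈ (kernelZigzag K T n p).reach i j := by
  induction j, hij using Fin.le_castSucc_induction with
  | refl =>
    rw [mem_persistentGroup, ZigzagModule.reach_self]
    constructor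
    · rintro ⟨z, hz, rfl⟩
      exact ⟨hz i le_rfl le_rfl, trivial⟩
    · rintro ⟨hx, -⟩
      refine ⟨x, fun l hil hli => ?_, filtrationMap_self K p i x⟩
      obtain rfl := le_antisymm hil hli
      rwa [filtrationMap_self]
  | step l h ih =>
    rw [mem_persistentGroup_succ K T h]
    constructor
    · rintro ⟨y, hy, rfl, hx⟩
      obtain ⟨hy1, hy2⟩ := (ih y).mp hy
      exact ⟨hx, (ZigzagModule.mem_reach_succ _ h _).mpr
        ⟨⟨y, Submodule.mem_inf.mpr ⟨hy1, hx⟩⟩, hy2, rfl⟩⟩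
    · rintro ⟨hx, hr⟩
      obtain ⟨w, hw, hwx⟩ := (ZigzagModule.mem_reach_succ _ h _).mp hr
      exact ⟨w.1, (ih w.1).mpr ⟨_, hw⟩, congrArg Subtype.val hwx, hx⟩

theorem finrank_persistentGroup {n p : ℕ} {i j : Fin (N + 1)} (hij : i ≤ j) :
    Module.finrank k (persistentGroup K T n p hij) =
      Module.finrank k ((kernelZigzag K T n p).reach i j) := by
  have h : persistentGroup K T n p hij = Submodule.map (kernelV K T n p j).subtype
      ((kernelZigzag K T n p).reach i j) := by
    ext x
    refine (mem_persistentGroup_iff_exists_mem_reach K T hij x).trans ?_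
    exact ⟨fun ⟨hx, hr⟩ => ⟨⟨x, hx⟩, hr, rfl⟩, fun ⟨y, hy, hyx⟩ => hyx ▸ ⟨y.2, hy⟩⟩
  rw [h]
  exact Submodule.finrank_map_subtype_eq _ _

end Persistence

end

theorem mainTheorem2 {k : Type u} [Field k] {N : ℕ} (K : ComposableArrows TopCat.{u} N)
    (hK : ∀ (i : Fin (N + 1)) (q : ℕ), FiniteDimensional k (singHomology k q (K.obj i)))
    (T : ∀ i : Fin (N + 1), TransferDiagram k (K.obj i)) (n p : ℕ) (hn : 1 ≤ n) :
    Nonempty (kernelZigzag K T n p).IntervalDecomposition ∧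
    ∀ D : (kernelZigzag K T n p).IntervalDecomposition,
      (∀ m, Even (D.birth m)) ∧
      (∀ D' : (kernelZigzag K T n p).IntervalDecomposition, D'.barcode = D.barcode) ∧
      ∀ (i j : Fin (N + 1)) (hij : i ≤ j),
        Module.finrank k (persistentGroup K T n p hij) =
          D.barcode.countP fun β => β.1 ≤ (i : ℕ) ∧ (j : ℕ) ≤ β.2 := by
  have hU : ∀ l, Function.Injective ((kernelZigzag K T n p).backward l) := fun l =>
    Submodule.inclusion_injective inf_le_left
  have hfin : ∀ l, FiniteDimensional k ((kernelZigzag K T n p).V l) := fun l =>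
    have := hK l p
    inferInstanceAs (FiniteDimensional k (kernelV K T n p l))
  refine ⟨ZigzagModule.nonempty_intervalDecomposition _ hU hfin, fun D =>
    ⟨D.even_birth hU, fun D' => ZigzagModule.IntervalDecomposition.barcode_eq hU D' D,
      fun i j hij => ?_⟩⟩
  rw [finrank_persistentGroup, D.finrank_reach (D.even_birth hU) hij]
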